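/- For total functions $f,g:\omega\to\omega$ write $f\le_{PR}g$ if $f=\Psi^{g}$ for some primitive recursive scheme $\Psi$ with oracle $g$. A \emph{punctual structure} is a structure with domain $\omega$, in a finite or countably infinite signature with (primitive recursively) coded symbols and computable arities, whose operations and relations are uniformly primitive recursive. Two punctual structures in the same signature are \emph{punctually isomorphic} if there is an isomorphism $g$ between them such that both $g$ and $g^{-1}$ are primitive recursive. A total function $f:\omega\to\omega$ is \emph{low for punctual isomorphism} if, whenever $A$ and $B$ are punctual structures in the same signature and $g:A\to B$ is an isomorphism with $g\oplus g^{-1}\le_{PR}f$, the structures $A$ and $B$ are punctually isomorphic. **Theorem.** Let $\mathbf d$ be a non-zero c.e. Turing degree. Then there is a total function $f:\omega\to\omega$ of Turing degree $\mathbf d$ that is low for punctual isomorphism. -/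

import Mathlib

open scoped Computability

/-! ### Primitive recursive reducibility between total functions -/

/-- Primitive recursive schemes with a symbol for one oracle function. Tuples of natural numbers
are coded by `Nat.pair`, as in `Nat.Primrec`. -/
inductive PRScheme : Type
  | zero : PRScheme
  | succ : PRScheme
  | left : PRScheme
  | right : PRScheme
  | oracle : PRScheme
  | pair : PRScheme → PRScheme → PRScheme
  | comp : PRScheme → PRScheme → PRScheme
  | prec : PRScheme → PRScheme → PRScheme

/-- `Ψ.eval g` is the total function computed by the scheme `Ψ` with oracle `g`. -/
def PRScheme.eval (g : ℕ → ℕ) : PRScheme → ℕ → ℕ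
  | .zero => fun _ => 0
  | .succ => Nat.succ
  | .left => fun n => n.unpair.1
  | .right => fun n => n.unpair.2
  | .oracle => g
  | .pair a b => fun n => Nat.pair (a.eval g n) (b.eval g n)
  | .comp a b => fun n => a.eval g (b.eval g n)
  | .prec a b => Nat.unpaired fun z n =>
      n.rec (a.eval g z) fun y IH => b.eval g (Nat.pair z (Nat.pair y IH))

/-- `f` is primitive recursively reducible to `g`. -/
def PRReducible (f g : ℕ → ℕ) : Prop :=
  ∃ Ψ : PRScheme, Ψ.eval g = f

/-- The join `f ⊕ g`, equal to `f n` at `2 * n` and to `g n` at `2 * n + 1`. -/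
def joinFun (f g : ℕ → ℕ) (k : ℕ) : ℕ :=
  if k % 2 = 0 then f (k / 2) else g (k / 2)

/-! ### Punctual structures -/

/-- A structure with domain `ℕ` is punctual if its operations and relations are uniformly primitive
recursive: one primitive recursive function evaluates every operation, and one primitive recursive
Boolean function decides every relation, given (the code of) a symbol and a tuple of arguments whose
length is the arity of that symbol. -/
def IsPunctual (L : FirstOrder.Language.{0, 0})
    [Primcodable (Σ n, L.Functions n)] [Primcodable (Σ n, L.Relations n)]
    (A : L.Structure ℕ) : Prop :=
  (∃ F : (Σ n, L.Functions n) × List ℕ → ℕ, Primrec F ∧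
    ∀ (n : ℕ) (s : L.Functions n) (v : Fin n → ℕ),
      F (⟨n, s⟩, List.ofFn v) = A.funMap s v) ∧
  (∃ R : (Σ n, L.Relations n) × List ℕ → Bool, Primrec R ∧
    ∀ (n : ℕ) (r : L.Relations n) (v : Fin n → ℕ),
      R (⟨n, r⟩, List.ofFn v) = true ↔ A.RelMap r v)

/-- The bijection of `ℕ` underlying an isomorphism between two structures with domain `ℕ`. -/
def isoPerm {L : FirstOrder.Language.{0, 0}} {A B : L.Structure ℕ}
    (g : @FirstOrder.Language.Equiv L ℕ ℕ A B) : Equiv.Perm ℕ :=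
  @FirstOrder.Language.Equiv.toEquiv L ℕ ℕ A B g

/-- Two structures on `ℕ` are punctually isomorphic if there is an isomorphism between them which is
primitive recursive and has a primitive recursive inverse. -/
def PunctuallyIsomorphic (L : FirstOrder.Language.{0, 0}) (A B : L.Structure ℕ) : Prop :=
  ∃ g : @FirstOrder.Language.Equiv L ℕ ℕ A B,
    Nat.Primrec (isoPerm g) ∧ Nat.Primrec (isoPerm g).symm

/-- `f` is low for punctual isomorphism: in every signature (finite or countably infinite) with
coded symbols and computable arities, any two punctual structures with an isomorphism `g` such that
`g ⊕ g⁻¹` is primitive recursively reducible to `f` are punctually isomorphic. -/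
def LowForPunctualIsomorphism (f : ℕ → ℕ) : Prop :=
  ∀ (L : FirstOrder.Language.{0, 0})
    [Primcodable (Σ n, L.Functions n)] [Primcodable (Σ n, L.Relations n)],
    Computable (fun s : Σ n, L.Functions n => s.1) →
    Computable (fun r : Σ n, L.Relations n => r.1) →
    ∀ A B : L.Structure ℕ, IsPunctual L A → IsPunctual L B →
      ∀ g : @FirstOrder.Language.Equiv L ℕ ℕ A B,
        PRReducible (joinFun (isoPerm g) (isoPerm g).symm) f → PunctuallyIsomorphic L A B

/-! ### Turing degrees -/

/-- The Turing degree of a total function. -/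
def turingDegreeOf (f : ℕ → ℕ) : TuringDegree :=
  toAntisymmetrization TuringReducible (f : ℕ →. ℕ)

open Classical in
/-- The characteristic function of a set of natural numbers. -/
noncomputable def charFun (W : Set ℕ) (n : ℕ) : ℕ :=
  if n ∈ W then 1 else 0

/-- A Turing degree is c.e. if it contains (the characteristic function of) a c.e. set. -/
def IsCEDegree (d : TuringDegree) : Prop :=
  ∃ W : Set ℕ, REPred (fun n => n ∈ W) ∧ turingDegreeOf (charFun W) = d

/-- The least Turing degree, that of the computable total functions. -/
def zeroTuringDegree : TuringDegree :=
  turingDegreeOf fun _ => 0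

/-! Let `W` be a c.e. set in the degree, with stages `W_n`, and let `f n` be the largest `j ≤ n`
such that `W_n` is correct below `j`. This function is unbounded, so searching for `s` with `f s >
n` decides `n ∈ W` from `W_s`; conversely `W` computes `f`. Hence `f` has the degree of `W`.

Suppose `Ψ` with oracle `f` gives `g ⊕ g⁻¹`, yet `A` and `B` are not punctually isomorphic. If `W_m`
is correct below `i`, then `min (f n) i` is primitive recursive in `n`, since `W_m` can replace `W`
in its definition. With this truncated oracle `Ψ` yields a primitive recursive function, which
cannot be the join of an isomorphism and its inverse, so a finite search finds a defect. Let `u`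
bound the oracle queries behind it. If `f ≤ i` below `u`, the truncated oracle agrees with `f` there
and `g` has the same defect, which is absurd. So `f n > i` for some `n < u`, and `W_u` is correct
below `i + 1`. Iterating computes `W`, contradicting that the degree is non-zero.

The argument rests on `PRScheme.eval_eq_of_agree_useBelow`, `isoDefect_congr`,
`exists_iso_of_isoDefect_eq_false` and `agree_stage_eq_min_inverseSettling`. -/

namespace PRScheme

/-- `Ψ.use g n` strictly bounds the oracle queries made in evaluating `Ψ.eval g n`. -/
def use (g : ℕ → ℕ) : PRScheme → ℕ → ℕ
  | .zero => fun _ => 0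
  | .succ => fun _ => 0
  | .left => fun _ => 0
  | .right => fun _ => 0
  | .oracle => fun n => n + 1
  | .pair a b => fun n => max (a.use g n) (b.use g n)
  | .comp a b => fun n => max (b.use g n) (a.use g (b.eval g n))
  | .prec a b => Nat.unpaired fun z n =>
      n.rec (a.use g z) fun y u =>
        max u (b.use g (Nat.pair z (Nat.pair y ((PRScheme.prec a b).eval g (Nat.pair z y)))))

theorem eval_eq_of_agree {g h : ℕ → ℕ} (Ψ : PRScheme) :
    ∀ n, (∀ k < Ψ.use g n, g k = h k) → Ψ.eval g n = Ψ.eval h n := by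
  induction Ψ with
  | zero | succ | left | right => intro n _; rfl
  | oracle => intro n H; exact H n (Nat.lt_succ_self n)
  | pair a b iha ihb =>
    intro n H
    simp only [use, lt_max_iff] at H
    simp only [eval]
    rw [iha n fun k hk => H k (.inl hk), ihb n fun k hk => H k (.inr hk)]
  | comp a b iha ihb =>
    intro n H
    simp only [use, lt_max_iff] at H
    simp only [eval]
    rw [iha _ fun k hk => H k (.inr hk), ihb n fun k hk => H k (.inl hk)]
  | prec a b iha ihb =>
    intro p
    obtain ⟨z, n, rfl⟩ : ∃ z n, p = Nat.pair z n := ⟨_, _, (Nat.pair_unpair p).symm⟩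
    induction n with
    | zero =>
      intro H
      simp only [use, eval, Nat.unpaired, Nat.unpair_pair] at H ⊢
      exact iha z H
    | succ n ih =>
      intro H
      simp only [use, Nat.unpaired, Nat.unpair_pair, lt_max_iff] at H ih
      have h1 := ih fun k hk => H k (.inl hk)
      have h2 := ihb _ fun k hk => H k (.inr hk)
      simp only [eval, Nat.unpaired, Nat.unpair_pair] at h1 h2 ⊢
      -- The use of the step is measured at the intermediate value computed from `g`, so the step is
      -- transferred to `h` before that value is.
      rw [h2, h1]

variable {α : Type*} [Primcodable α]

/-- Uniformity in the parameter `a` matters: the truncated oracles vary with `(i, m)`, and the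
search for defects must be computable in that pair. -/
theorem primrec_eval {O : α → ℕ → ℕ} (hO : Primrec₂ O) (Ψ : PRScheme) :
    Primrec₂ fun a n => Ψ.eval (O a) n := by
  induction Ψ with
  | zero => exact Primrec₂.const 0
  | succ => exact Primrec.succ.comp Primrec.snd
  | left => exact Primrec.fst.comp (Primrec.unpair.comp Primrec.snd)
  | right => exact Primrec.snd.comp (Primrec.unpair.comp Primrec.snd)
  | oracle => exact hO
  | pair a b iha ihb => exact Primrec₂.natPair.comp iha ihb
  | comp a b iha ihb => exact iha.comp Primrec.fst ihb
  | prec a b iha ihb =>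
    refine Primrec.nat_rec' (f := fun p : α × ℕ => p.2.unpair.2)
      (g := fun p => a.eval (O p.1) p.2.unpair.1)
      (h := fun p q => b.eval (O p.1) (Nat.pair p.2.unpair.1 (Nat.pair q.1 q.2))) ?_ ?_ ?_
    · exact Primrec.snd.comp (Primrec.unpair.comp Primrec.snd)
    · exact iha.comp Primrec.fst (Primrec.fst.comp (Primrec.unpair.comp Primrec.snd))
    · exact ihb.comp (Primrec.fst.comp Primrec.fst)
        (Primrec₂.natPair.comp
          (Primrec.fst.comp (Primrec.unpair.comp (Primrec.snd.comp Primrec.fst)))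
          (Primrec₂.natPair.comp (Primrec.fst.comp Primrec.snd) (Primrec.snd.comp Primrec.snd)))

theorem primrec_use {O : α → ℕ → ℕ} (hO : Primrec₂ O) (Ψ : PRScheme) :
    Primrec₂ fun a n => Ψ.use (O a) n := by
  induction Ψ with
  | zero | succ | left | right => exact Primrec₂.const 0
  | oracle => exact Primrec.succ.comp Primrec.snd
  | pair a b iha ihb => exact Primrec.nat_max.comp iha ihb
  | comp a b iha ihb =>
    exact Primrec.nat_max.comp ihb (iha.comp Primrec.fst (b.primrec_eval hO))
  | prec a b iha ihb =>
    refine Primrec.nat_rec' (f := fun p : α × ℕ => p.2.unpair.2)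
      (g := fun p => a.use (O p.1) p.2.unpair.1)
      (h := fun p q => max q.2 (b.use (O p.1) (Nat.pair p.2.unpair.1 (Nat.pair q.1
        ((PRScheme.prec a b).eval (O p.1) (Nat.pair p.2.unpair.1 q.1)))))) ?_ ?_ ?_
    · exact Primrec.snd.comp (Primrec.unpair.comp Primrec.snd)
    · exact iha.comp Primrec.fst (Primrec.fst.comp (Primrec.unpair.comp Primrec.snd))
    · have hz : Primrec fun x : (α × ℕ) × (ℕ × ℕ) => x.1.2.unpair.1 :=
        Primrec.fst.comp (Primrec.unpair.comp (Primrec.snd.comp Primrec.fst))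
      have hy : Primrec fun x : (α × ℕ) × (ℕ × ℕ) => x.2.1 := Primrec.fst.comp Primrec.snd
      have ha : Primrec fun x : (α × ℕ) × (ℕ × ℕ) => x.1.1 := Primrec.fst.comp Primrec.fst
      exact Primrec.nat_max.comp (Primrec.snd.comp Primrec.snd)
        (ihb.comp ha (Primrec₂.natPair.comp hz (Primrec₂.natPair.comp hy
          (((PRScheme.prec a b).primrec_eval hO).comp ha (Primrec₂.natPair.comp hz hy)))))

/-- A strict bound for the oracle queries made in evaluating `Ψ` at all arguments below `b`. -/
def useBelow (g : ℕ → ℕ) (Ψ : PRScheme) (b : ℕ) : ℕ :=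
  b.rec 0 fun k u => max u (Ψ.use g k)

theorem use_le_useBelow (g : ℕ → ℕ) (Ψ : PRScheme) {k b : ℕ} (h : k < b) :
    Ψ.use g k ≤ Ψ.useBelow g b := by
  induction b with
  | zero => omega
  | succ b ih =>
    rcases Nat.lt_succ_iff_lt_or_eq.1 h with h | rfl
    · exact (ih h).trans (le_max_left _ _)
    · exact le_max_right _ _

theorem eval_eq_of_agree_useBelow {g h : ℕ → ℕ} (Ψ : PRScheme) {b : ℕ}
    (H : ∀ k < Ψ.useBelow g b, g k = h k) {n : ℕ} (hn : n < b) : Ψ.eval g n = Ψ.eval h n :=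
  Ψ.eval_eq_of_agree n fun k hk => H k (hk.trans_le (Ψ.use_le_useBelow g hn))

theorem primrec_useBelow {O : α → ℕ → ℕ} (hO : Primrec₂ O) (Ψ : PRScheme) :
    Primrec₂ fun a b => Ψ.useBelow (O a) b := by
  refine Primrec.nat_rec' (f := fun p : α × ℕ => p.2) (g := fun _ => 0)
    (h := fun p q => max q.2 (Ψ.use (O p.1) q.1)) Primrec.snd (Primrec.const 0) ?_
  exact Primrec.nat_max.comp (Primrec.snd.comp Primrec.snd)
    ((Ψ.primrec_use hO).comp (Primrec.fst.comp Primrec.fst) (Primrec.fst.comp Primrec.snd))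

end PRScheme

/-! ### Refuting that a function is the join of an isomorphism and its inverse -/

/-- Evaluate a Boolean condition on the pair of a symbol and an argument tuple coded by `t`, where
the tuple must have the right length and entries at most `b`. -/
def tupleTest {S : Type} [Primcodable S] (ar : S → ℕ) (φ : S × List ℕ → Bool) (b t : ℕ) : Bool :=
  ((Encodable.decode (α := S × List ℕ) t).map fun q =>
    q.2.length == ar q.1 && (decide (∀ x ∈ q.2, x ≤ b) && φ q)).getD false

theorem tupleTest_eq_true {S : Type} [Primcodable S] {ar : S → ℕ} {φ : S × List ℕ → Bool}
    {b t : ℕ} : tupleTest ar φ b t = true ↔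
      ∃ q, Encodable.decode (α := S × List ℕ) t = some q ∧ q.2.length = ar q.1 ∧
        (∀ x ∈ q.2, x ≤ b) ∧ φ q = true := by
  unfold tupleTest
  cases Encodable.decode (α := S × List ℕ) t <;> simp

theorem computable_tupleTest {S α : Type} [Primcodable S] [Primcodable α] {ar : S → ℕ}
    (har : Computable ar) {φ : α → ℕ → S × List ℕ → Bool}
    (hφ : Primrec fun x : (α × ℕ) × (S × List ℕ) => φ x.1.1 x.1.2 x.2) {b t : α → ℕ}
    (hb : Computable b) (ht : Computable t) :
    Computable fun a => tupleTest ar (φ a (b a)) (b a) (t a) := by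
  have hle : Primrec₂ fun (l : List ℕ) (b : ℕ) => decide (∀ x ∈ l, x ≤ b) :=
    (PrimrecRel.forall_mem_list Primrec.nat_le).decide
  refine Computable.option_getD (Computable.option_map (Computable.decode.comp ht) ?_)
    (Computable.const false)
  have hq : Computable fun x : α × (S × List ℕ) => x.2 := Computable.snd
  have hl : Computable fun x : α × (S × List ℕ) => x.2.2 := Computable.snd.comp hq
  have hb' : Computable fun x : α × (S × List ℕ) => b x.1 := hb.comp Computable.fst
  refine Primrec.and.to_comp.comp (Primrec.beq.to_comp.comp (Primrec.list_length.to_comp.comp hl)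
    (har.comp (Computable.fst.comp hq))) (Primrec.and.to_comp.comp (hle.to_comp.comp hl hb') ?_)
  exact hφ.to_comp.comp ((Computable.fst.pair hb').pair hq)

section Defect

variable {L : FirstOrder.Language.{0, 0}}
  [Primcodable (Σ n, L.Functions n)] [Primcodable (Σ n, L.Relations n)]

/-- The operations `F` and `F'` do not commute at `q` with the even part of `J`. -/
def functionDefect {S : Type} (F F' : S × List ℕ → ℕ) (J : ℕ → ℕ) (b : ℕ) (q : S × List ℕ) : Bool :=
  decide (F q ≤ b) && !(J (2 * F q) == F' (q.1, q.2.map fun x => J (2 * x)))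

/-- The relations `R` and `R'` differ at `q` and its image under the even part of `J`. -/
def relationDefect {S : Type} (R R' : S × List ℕ → Bool) (J : ℕ → ℕ) (q : S × List ℕ) : Bool :=
  !(R q == R' (q.1, q.2.map fun x => J (2 * x)))

/-- The odd part of `J` fails to be a right inverse of the even part at `t`. -/
def rightInverseDefect (J : ℕ → ℕ) (b t : ℕ) : Bool :=
  decide (t ≤ b) && (decide (J (2 * t + 1) ≤ b) && !(J (2 * J (2 * t + 1)) == t))

/-- The odd part of `J` fails to be a left inverse of the even part at `t`. -/
def leftInverseDefect (J : ℕ → ℕ) (b t : ℕ) : Bool :=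
  decide (t ≤ b) && (decide (J (2 * t) ≤ b) && !(J (2 * J (2 * t) + 1) == t))

/-- `t` codes evidence, using only the values of `J` up to `2 * b + 1`, that `J` is not the join of
an isomorphism and its inverse. -/
def isoDefect (F F' : (Σ n, L.Functions n) × List ℕ → ℕ)
    (R R' : (Σ n, L.Relations n) × List ℕ → Bool) (J : ℕ → ℕ) (b t : ℕ) : Bool :=
  (rightInverseDefect J b t || leftInverseDefect J b t) ||
    (tupleTest (fun s : Σ n, L.Functions n => s.1) (functionDefect F F' J b) b t ||
      tupleTest (fun s : Σ n, L.Relations n => s.1) (relationDefect R R' J) b t)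

variable {F F' : (Σ n, L.Functions n) × List ℕ → ℕ} {R R' : (Σ n, L.Relations n) × List ℕ → Bool}

theorem tupleTest_congr {S : Type} [Primcodable S] {ar : S → ℕ} {φ ψ : S × List ℕ → Bool}
    {b t : ℕ} (h : ∀ q : S × List ℕ, (∀ x ∈ q.2, x ≤ b) → φ q = ψ q) :
    tupleTest ar φ b t = tupleTest ar ψ b t := by
  rw [Bool.eq_iff_iff, tupleTest_eq_true, tupleTest_eq_true]
  refine exists_congr fun q => and_congr_right fun _ => and_congr_right fun _ =>
    and_congr_right fun hq => ?_
  rw [h q hq]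

/-- Each test caps by `b` every number whose image or preimage it reads from `J`, including
intermediate values such as `F q`. -/
theorem isoDefect_congr {J J' : ℕ → ℕ} {b : ℕ} (h : ∀ k < 2 * b + 2, J k = J' k) (t : ℕ) :
    isoDefect F F' R R' J b t = isoDefect F F' R R' J' b t := by
  have he : ∀ k ≤ b, J (2 * k) = J' (2 * k) := fun k hk => h _ (by omega)
  have ho : ∀ k ≤ b, J (2 * k + 1) = J' (2 * k + 1) := fun k hk => h _ (by omega)
  have hmap : ∀ l : List ℕ, (∀ x ∈ l, x ≤ b) →
      (l.map fun x => J (2 * x)) = l.map fun x => J' (2 * x) := fun l hl =>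
    List.map_congr_left fun x hx => he x (hl x hx)
  unfold isoDefect
  congr 1
  · congr 1
    · unfold rightInverseDefect
      by_cases ht : t ≤ b
      · rw [ho t ht]
        by_cases ht' : J' (2 * t + 1) ≤ b
        · rw [he _ ht']
        · simp [ht']
      · simp [ht]
    · unfold leftInverseDefect
      by_cases ht : t ≤ b
      · rw [he t ht]
        by_cases ht' : J' (2 * t) ≤ b
        · rw [ho _ ht']
        · simp [ht']
      · simp [ht]
  · congr 1
    · refine tupleTest_congr fun q hq => ?_
      unfold functionDefect
      rw [hmap _ hq]
      by_cases hF : F q ≤ b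
      · rw [he _ hF]
      · simp [hF]
    · refine tupleTest_congr fun q hq => ?_
      unfold relationDefect
      rw [hmap _ hq]

/-- Only computability is available, since arities are merely computable; it suffices because the
test is used inside an unbounded search. -/
theorem computable_isoDefect {α : Type} [Primcodable α]
    (harF : Computable fun s : Σ n, L.Functions n => s.1)
    (harR : Computable fun r : Σ n, L.Relations n => r.1)
    (hF : Primrec F) (hF' : Primrec F') (hR : Primrec R) (hR' : Primrec R')
    {J : α → ℕ → ℕ} (hJ : Primrec₂ J) {b t : α → ℕ} (hb : Computable b) (ht : Computable t) :
    Computable fun a => isoDefect F F' R R' (J a) (b a) (t a) := by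
  have he : Primrec₂ fun (a : α) (k : ℕ) => J a (2 * k) :=
    hJ.comp Primrec.fst (Primrec.nat_mul.comp (Primrec.const 2) Primrec.snd)
  have ho : Primrec₂ fun (a : α) (k : ℕ) => J a (2 * k + 1) :=
    hJ.comp Primrec.fst (Primrec.succ.comp (Primrec.nat_mul.comp (Primrec.const 2) Primrec.snd))
  have hbt : Computable fun a => (a, b a, t a) := Computable.id.pair (hb.pair ht)
  have pb : Primrec fun x : α × ℕ × ℕ => x.2.1 := Primrec.fst.comp Primrec.snd
  have pt : Primrec fun x : α × ℕ × ℕ => x.2.2 := Primrec.snd.comp Primrec.snd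
  have le : ∀ {u v : α × ℕ × ℕ → ℕ}, Primrec u → Primrec v →
      Primrec fun x => decide (u x ≤ v x) := fun hu hv => Primrec.nat_le.decide.comp hu hv
  have h1 : Primrec fun x : α × ℕ × ℕ => rightInverseDefect (J x.1) x.2.1 x.2.2 := by
    have := ho.comp Primrec.fst pt
    exact Primrec.and.comp (le pt pb) (Primrec.and.comp (le this pb)
      (Primrec.not.comp (Primrec.beq.comp (he.comp Primrec.fst this) pt)))
  have h2 : Primrec fun x : α × ℕ × ℕ => leftInverseDefect (J x.1) x.2.1 x.2.2 := by
    have := he.comp Primrec.fst pt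
    exact Primrec.and.comp (le pt pb) (Primrec.and.comp (le this pb)
      (Primrec.not.comp (Primrec.beq.comp (ho.comp Primrec.fst this) pt)))
  have hmap : ∀ {S : Type} [Primcodable S], Primrec fun x : (α × ℕ) × (S × List ℕ) =>
      (x.2.1, x.2.2.map fun k => J x.1.1 (2 * k)) := fun {S} _ =>
    (Primrec.fst.comp Primrec.snd).pair (Primrec.list_map (Primrec.snd.comp Primrec.snd)
      (he.comp (Primrec.fst.comp (Primrec.fst.comp Primrec.fst)) Primrec.snd))
  refine Primrec.or.to_comp.comp
    (Primrec.or.to_comp.comp (h1.to_comp.comp hbt) (h2.to_comp.comp hbt))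
    (Primrec.or.to_comp.comp
      (computable_tupleTest harF (φ := fun a b => functionDefect F F' (J a) b) ?_ hb ht)
      (computable_tupleTest harR (φ := fun a _ => relationDefect R R' (J a)) ?_ hb ht))
  · have hFq : Primrec fun x : (α × ℕ) × ((Σ n, L.Functions n) × List ℕ) => F x.2 :=
      hF.comp Primrec.snd
    exact Primrec.and.comp
      (Primrec.nat_le.decide.comp hFq (Primrec.snd.comp Primrec.fst))
      (Primrec.not.comp (Primrec.beq.comp (he.comp (Primrec.fst.comp Primrec.fst) hFq)
        (hF'.comp hmap)))
  · exact Primrec.not.comp (Primrec.beq.comp (hR.comp Primrec.snd) (hR'.comp hmap))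

theorem isoDefect_eq_true {J : ℕ → ℕ} {b t : ℕ} : isoDefect F F' R R' J b t = true ↔
    (t ≤ b ∧ J (2 * t + 1) ≤ b ∧ J (2 * J (2 * t + 1)) ≠ t) ∨
    (t ≤ b ∧ J (2 * t) ≤ b ∧ J (2 * J (2 * t) + 1) ≠ t) ∨
    (∃ q : (Σ n, L.Functions n) × List ℕ, Encodable.decode t = some q ∧ q.2.length = q.1.1 ∧
      (∀ x ∈ q.2, x ≤ b) ∧ F q ≤ b ∧ J (2 * F q) ≠ F' (q.1, q.2.map fun x => J (2 * x))) ∨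
    (∃ q : (Σ n, L.Relations n) × List ℕ, Encodable.decode t = some q ∧ q.2.length = q.1.1 ∧
      (∀ x ∈ q.2, x ≤ b) ∧ R q ≠ R' (q.1, q.2.map fun x => J (2 * x))) := by
  simp [isoDefect, rightInverseDefect, leftInverseDefect, functionDefect, relationDefect,
    tupleTest_eq_true, or_assoc]

variable {A B : L.Structure ℕ}

/-- Any failure of an inverse law or of preservation becomes visible once `b` is large enough to
pass the guards. -/
theorem exists_iso_of_isoDefect_eq_false
    (hF : ∀ (n : ℕ) (s : L.Functions n) (v : Fin n → ℕ), F (⟨n, s⟩, List.ofFn v) = A.funMap s v)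
    (hF' : ∀ (n : ℕ) (s : L.Functions n) (v : Fin n → ℕ), F' (⟨n, s⟩, List.ofFn v) = B.funMap s v)
    (hR : ∀ (n : ℕ) (r : L.Relations n) (v : Fin n → ℕ),
      R (⟨n, r⟩, List.ofFn v) = true ↔ A.RelMap r v)
    (hR' : ∀ (n : ℕ) (r : L.Relations n) (v : Fin n → ℕ),
      R' (⟨n, r⟩, List.ofFn v) = true ↔ B.RelMap r v)
    {J : ℕ → ℕ} (hJ : ∀ b t, isoDefect F F' R R' J b t = false) :
    ∃ g : @FirstOrder.Language.Equiv L ℕ ℕ A B,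
      (∀ k, isoPerm g k = J (2 * k)) ∧ ∀ k, (isoPerm g).symm k = J (2 * k + 1) := by
  have key : ∀ b t, ¬ isoDefect F F' R R' J b t = true := fun b t => by simp [hJ b t]
  simp only [isoDefect_eq_true, not_or] at key
  have hr : ∀ t, J (2 * J (2 * t + 1)) = t := fun t => by
    by_contra h
    exact (key (max t (J (2 * t + 1))) t).1 ⟨le_max_left _ _, le_max_right _ _, h⟩
  have hl : ∀ t, J (2 * J (2 * t) + 1) = t := fun t => by
    by_contra h
    exact (key (max t (J (2 * t))) t).2.1 ⟨le_max_left _ _, le_max_right _ _, h⟩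
  -- The sum serves as a convenient common bound for the entries of a tuple.
  have hle : ∀ l : List ℕ, ∀ x ∈ l, x ≤ l.sum := fun l x hx => List.le_sum_of_mem hx
  refine ⟨@FirstOrder.Language.Equiv.mk L ℕ ℕ A B
    ⟨fun k => J (2 * k), fun k => J (2 * k + 1), hl, hr⟩ ?_ ?_, fun k => rfl, fun k => rfl⟩
  · intro n s v
    by_contra h
    refine (key (max (List.ofFn v).sum (F (⟨n, s⟩, List.ofFn v)))
      (Encodable.encode ((⟨n, s⟩, List.ofFn v) : (Σ n, L.Functions n) × List ℕ))).2.2.1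
      ⟨_, Encodable.encodek _, List.length_ofFn, fun x hx => (hle _ x hx).trans (le_max_left _ _),
        le_max_right _ _, fun h' => h ?_⟩
    simp only [List.map_ofFn, hF, hF'] at h'
    exact h'
  · intro n r v
    by_contra h
    refine (key (List.ofFn v).sum
      (Encodable.encode ((⟨n, r⟩, List.ofFn v) : (Σ n, L.Relations n) × List ℕ))).2.2.2
      ⟨_, Encodable.encodek _, List.length_ofFn, hle _, fun h' => h ?_⟩
    have h1 := hR n r v
    have h2 := hR' n r ((fun k => J (2 * k)) ∘ v)
    simp only [List.map_ofFn] at h'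
    rw [h'] at h1
    exact h2.symm.trans h1

theorem isoDefect_joinFun
    (hF : ∀ (n : ℕ) (s : L.Functions n) (v : Fin n → ℕ), F (⟨n, s⟩, List.ofFn v) = A.funMap s v)
    (hF' : ∀ (n : ℕ) (s : L.Functions n) (v : Fin n → ℕ), F' (⟨n, s⟩, List.ofFn v) = B.funMap s v)
    (hR : ∀ (n : ℕ) (r : L.Relations n) (v : Fin n → ℕ),
      R (⟨n, r⟩, List.ofFn v) = true ↔ A.RelMap r v)
    (hR' : ∀ (n : ℕ) (r : L.Relations n) (v : Fin n → ℕ),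
      R' (⟨n, r⟩, List.ofFn v) = true ↔ B.RelMap r v)
    (g : @FirstOrder.Language.Equiv L ℕ ℕ A B) (b t : ℕ) :
    isoDefect F F' R R' (joinFun (isoPerm g) (isoPerm g).symm) b t = false := by
  have he : ∀ k, joinFun (isoPerm g) (isoPerm g).symm (2 * k) = isoPerm g k := fun k => by
    simp [joinFun]
  have ho : ∀ k, joinFun (isoPerm g) (isoPerm g).symm (2 * k + 1) = (isoPerm g).symm k :=
    fun k => by
      have h : (2 * k + 1) / 2 = k := by omega
      simp [joinFun, Nat.add_mod, h]
  rw [Bool.eq_false_iff, ne_eq, isoDefect_eq_true]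
  simp only [he, ho]
  rintro (⟨-, -, h⟩ | ⟨-, -, h⟩ | ⟨⟨⟨n, s⟩, l⟩, -, hl, -, -, h⟩ | ⟨⟨⟨n, r⟩, l⟩, -, hl, -, h⟩)
  · exact h (Equiv.apply_symm_apply _ _)
  · exact h (Equiv.symm_apply_apply _ _)
  · obtain ⟨v, rfl⟩ : ∃ v : Fin n → ℕ, List.ofFn v = l := by
      obtain rfl : l.length = n := hl
      exact ⟨l.get, List.ofFn_get l⟩
    rw [List.map_ofFn, hF, hF'] at h
    exact h (@FirstOrder.Language.Equiv.map_fun' L ℕ ℕ A B g _ s v)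
  · obtain ⟨v, rfl⟩ : ∃ v : Fin n → ℕ, List.ofFn v = l := by
      obtain rfl : l.length = n := hl
      exact ⟨l.get, List.ofFn_get l⟩
    rw [List.map_ofFn, ne_eq, Bool.eq_iff_iff, hR, hR'] at h
    exact h (@FirstOrder.Language.Equiv.map_rel' L ℕ ℕ A B g _ r v).symm

end Defect

/-! ### The inverse settling function of a c.e. set -/

/-- Stage `s` asks whether a code for the semidecision procedure halts under the bound `s` of
`evaln`. -/
theorem REPred.exists_primrec_stages {p : ℕ → Prop} (hp : REPred p) :
    ∃ E : ℕ → ℕ → Bool, Primrec₂ E ∧ (∀ s s' n, s ≤ s' → E s n = true → E s' n = true) ∧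
      ∀ n, p n ↔ ∃ s, E s n = true := by
  obtain ⟨c, hc⟩ := Nat.Partrec.Code.exists_code.1 hp
  refine ⟨fun s n => (Nat.Partrec.Code.evaln s c n).isSome, ?_, ?_, ?_⟩
  · exact Primrec.option_isSome.comp (Nat.Partrec.Code.primrec_evaln.comp
      ((Primrec.fst.pair (Primrec.const c)).pair Primrec.snd))
  · intro s s' n h hs
    obtain ⟨x, hx⟩ := Option.isSome_iff_exists.1 hs
    exact Option.isSome_iff_exists.2 ⟨x, Nat.Partrec.Code.evaln_mono h hx⟩
  · intro n
    have h : p n ↔ (c.eval n).Dom := by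
      rw [hc]
      simp [Part.assert]
    rw [h, Part.dom_iff_mem]
    simp only [Nat.Partrec.Code.evaln_complete, Option.isSome_iff_exists, Option.mem_def]
    exact exists_comm

/-- The largest `j ≤ k` such that stage `n` of the enumeration `E` contains all elements of `V`
below `j`. -/
def agree (E : ℕ → ℕ → Bool) (V : ℕ → Bool) (n k : ℕ) : ℕ :=
  k.rec 0 fun i r => bif (r == i) && (!V i || E n i) then i + 1 else r

section agree

variable {E : ℕ → ℕ → Bool} {V : ℕ → Bool}

/-- The counter in `agree` keeps pace with the index until the first missing element of `V`, then
stays frozen. -/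
theorem le_agree_iff {n k j : ℕ} :
    j ≤ agree E V n k ↔ j ≤ k ∧ ∀ i < j, V i = true → E n i = true := by
  induction k generalizing j with
  | zero =>
    change j ≤ 0 ↔ _
    refine ⟨fun h => ⟨h, fun i hi => by omega⟩, And.left⟩
  | succ k ih =>
    have hs : agree E V n (k + 1) =
        bif (agree E V n k == k) && (!V k || E n k) then k + 1 else agree E V n k := rfl
    by_cases hc : agree E V n k = k ∧ (V k = true → E n k = true)
    · have : agree E V n (k + 1) = k + 1 := by
        have h2 : (!V k || E n k) = true := by
          have := hc.2
          cases hV : V k <;> simp_all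
        rw [hs, hc.1, h2, beq_self_eq_true, Bool.and_self, cond_true]
      rw [this]
      refine ⟨fun h => ⟨h, fun i hi hV => ?_⟩, And.left⟩
      rcases Nat.lt_succ_iff_lt_or_eq.1 (hi.trans_le h) with hi' | rfl
      · exact (ih.1 hc.1.ge).2 i hi' hV
      · exact hc.2 hV
    · have : agree E V n (k + 1) = agree E V n k := by
        rw [hs]
        by_cases h : agree E V n k = k
        · have h2 : (!V k || E n k) = false := by
            have := fun h' => hc ⟨h, h'⟩
            cases hV : V k <;> simp_all
          rw [h2, Bool.and_false, cond_false]
        · rw [beq_false_of_ne h, Bool.false_and, cond_false]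
      rw [this, ih]
      refine ⟨fun h => ⟨h.1.trans (Nat.le_succ k), h.2⟩, fun h => ⟨?_, h.2⟩⟩
      by_contra hj
      obtain rfl : j = k + 1 := by omega
      have h1 : k ≤ agree E V n k :=
        ih.2 ⟨le_rfl, fun i hi => h.2 i (hi.trans (Nat.lt_succ_self k))⟩
      exact hc ⟨le_antisymm (ih.1 le_rfl).1 h1, h.2 k (Nat.lt_succ_self k)⟩

theorem agree_congr {V' : ℕ → Bool} {n k : ℕ} (h : ∀ i < k, V i = V' i) :
    agree E V n k = agree E V' n k := by
  refine eq_of_forall_le_iff fun j => ?_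
  rw [le_agree_iff, le_agree_iff]
  refine and_congr_right fun hj => forall_congr' fun i => forall_congr' fun hi => ?_
  rw [h i (hi.trans_le hj)]

theorem agree_min (n k i : ℕ) : agree E V n (min k i) = min (agree E V n k) i := by
  refine eq_of_forall_le_iff fun j => ?_
  simp only [le_min_iff, le_agree_iff]
  tauto

theorem primrec_agree {α : Type} [Primcodable α] (hE : Primrec₂ E) {V : α → ℕ → Bool}
    (hV : Primrec₂ V) {n k : α → ℕ} (hn : Primrec n) (hk : Primrec k) :
    Primrec fun a => agree E (V a) (n a) (k a) := by
  refine Primrec.nat_rec' hk (Primrec.const 0)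
    (h := fun a q => bif (q.2 == q.1) && (!V a q.1 || E (n a) q.1) then q.1 + 1 else q.2) ?_
  have hi : Primrec fun x : α × (ℕ × ℕ) => x.2.1 := Primrec.fst.comp Primrec.snd
  have hr : Primrec fun x : α × (ℕ × ℕ) => x.2.2 := Primrec.snd.comp Primrec.snd
  exact Primrec.cond (Primrec.and.comp (Primrec.beq.comp hr hi) (Primrec.or.comp
    (Primrec.not.comp (hV.comp Primrec.fst hi)) (hE.comp (hn.comp Primrec.fst) hi)))
    (Primrec.succ.comp hi) hr

end agree

/-! ### Turing equivalence of a c.e. set and its inverse settling function -/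

namespace Nat.RecursiveIn

variable {O : Set (ℕ →. ℕ)} {f g : ℕ → ℕ}

theorem pair_total (hf : Nat.RecursiveIn O fun n => Part.some (f n))
    (hg : Nat.RecursiveIn O fun n => Part.some (g n)) :
    Nat.RecursiveIn O fun n => Part.some (Nat.pair (f n) (g n)) :=
  (hf.pair hg).of_eq fun n => by simp [Seq.seq]

theorem comp_total (hf : Nat.RecursiveIn O fun n => Part.some (f n))
    (hg : Nat.RecursiveIn O fun n => Part.some (g n)) :
    Nat.RecursiveIn O fun n => Part.some (f (g n)) :=
  (hf.comp hg).of_eq fun n => by simp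

theorem of_primrec (hf : Nat.Primrec f) : Nat.RecursiveIn O fun n => Part.some (f n) :=
  hf.recursiveIn

theorem prec_total (hf : Nat.RecursiveIn O fun n => Part.some (f n))
    (hg : Nat.RecursiveIn O fun n => Part.some (g n)) :
    Nat.RecursiveIn O fun p => Part.some
      (p.unpair.2.rec (f p.unpair.1) fun y i => g (Nat.pair p.unpair.1 (Nat.pair y i)) : ℕ) :=
  (hf.prec hg).of_eq fun p => by
    simp only
    induction p.unpair.2 with
    | zero => rfl
    | succ n ih =>
      simp only [Part.bind_eq_bind] at ih ⊢
      rw [ih, Part.bind_some]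

end Nat.RecursiveIn

section InverseSettling

variable {E : ℕ → ℕ → Bool} {W : Set ℕ}

open Classical in
/-- The largest `j ≤ n` such that stage `n` of the enumeration `E` of `W` is correct below `j`. -/
noncomputable def inverseSettling (E : ℕ → ℕ → Bool) (W : Set ℕ) (n : ℕ) : ℕ :=
  agree E (fun k => decide (k ∈ W)) n n

theorem le_inverseSettling_iff {n j : ℕ} :
    j ≤ inverseSettling E W n ↔ j ≤ n ∧ ∀ i < j, i ∈ W → E n i = true := by
  simp [inverseSettling, le_agree_iff]

theorem exists_le_inverseSettling
    (hmono : ∀ s s' n, s ≤ s' → E s n = true → E s' n = true)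
    (hW : ∀ n, n ∈ W ↔ ∃ s, E s n = true) (j : ℕ) : ∃ n, j ≤ inverseSettling E W n := by
  have : ∃ s, ∀ i < j, i ∈ W → E s i = true := by
    induction j with
    | zero => exact ⟨0, fun i hi => by omega⟩
    | succ j ih =>
      obtain ⟨s, hs⟩ := ih
      obtain ⟨s', hs'⟩ : ∃ s', j ∈ W → E s' j = true := by
        by_cases hj : j ∈ W
        · exact ((hW j).1 hj).imp fun _ h _ => h
        · exact ⟨0, fun h => absurd h hj⟩
      refine ⟨max s s', fun i hi hiW => ?_⟩
      rcases Nat.lt_succ_iff_lt_or_eq.1 hi with hi | rfl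
      · exact hmono _ _ _ (le_max_left _ _) (hs i hi hiW)
      · exact hmono _ _ _ (le_max_right _ _) (hs' hiW)
  obtain ⟨s, hs⟩ := this
  -- The maximum with `j` is needed because the inverse settling function at `n` is capped by `n`.
  exact ⟨max s j, le_inverseSettling_iff.2 ⟨le_max_right _ _, fun i hi hiW =>
    hmono _ _ _ (le_max_left _ _) (hs i hi hiW)⟩⟩

theorem inverseSettling_turingReducible (hE : Primrec₂ E) :
    TuringReducible (inverseSettling E W : ℕ → ℕ) (charFun W : ℕ → ℕ) := by
  rw [TuringReducible, RecursiveIn.iff_nat]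
  -- One step of the recursion defining `agree`: the left component of `x` codes stage, index and
  -- counter, the right one is the oracle's answer about the index.
  let G : ℕ → ℕ := fun x =>
    bif x.unpair.1.unpair.2.unpair.2 == x.unpair.1.unpair.2.unpair.1 &&
      (!(x.unpair.2 == 1) || E x.unpair.1.unpair.1 x.unpair.1.unpair.2.unpair.1)
    then x.unpair.1.unpair.2.unpair.1 + 1 else x.unpair.1.unpair.2.unpair.2
  have hG : Nat.Primrec G := by
    rw [← Primrec.nat_iff]
    have l : ∀ {u : ℕ → ℕ}, Primrec u → Primrec fun x => (u x).unpair.1 := fun hu =>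
      Primrec.fst.comp (Primrec.unpair.comp hu)
    have r : ∀ {u : ℕ → ℕ}, Primrec u → Primrec fun x => (u x).unpair.2 := fun hu =>
      Primrec.snd.comp (Primrec.unpair.comp hu)
    have hi := l (r (l Primrec.id))
    have hr := r (r (l Primrec.id))
    exact Primrec.cond (Primrec.and.comp (Primrec.beq.comp hr hi) (Primrec.or.comp
      (Primrec.not.comp (Primrec.beq.comp (r Primrec.id) (Primrec.const 1)))
      (hE.comp (l (l Primrec.id)) hi))) (Primrec.succ.comp hi) hr
  have horacle : Nat.RecursiveIn {((charFun W : ℕ → ℕ) : ℕ →. ℕ)}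
      fun n => Part.some (charFun W n) := .oracle _ rfl
  have hstep : Nat.RecursiveIn {((charFun W : ℕ → ℕ) : ℕ →. ℕ)}
      fun x => Part.some (G (Nat.pair x (charFun W x.unpair.2.unpair.1))) :=
    (Nat.RecursiveIn.of_primrec hG).comp_total
      ((Nat.RecursiveIn.of_primrec Nat.Primrec.id).pair_total (horacle.comp_total
        (Nat.RecursiveIn.of_primrec (Nat.Primrec.left.comp Nat.Primrec.right))))
  have hrec := ((Nat.RecursiveIn.of_primrec Nat.Primrec.zero).prec_total hstep).comp_total
    -- The input `n` is both the stage and the length of the recursion.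
    (Nat.RecursiveIn.of_primrec (Nat.Primrec.id.pair Nat.Primrec.id))
  refine hrec.of_eq fun n => ?_
  simp only [Nat.unpair_pair, PFun.coe_val, Part.some_inj, inverseSettling, agree, G, id_eq]
  congr 1
  funext i r
  by_cases h : i ∈ W <;> simp [charFun, h]

theorem charFun_turingReducible (hE : Primrec₂ E)
    (hmono : ∀ s s' n, s ≤ s' → E s n = true → E s' n = true)
    (hW : ∀ n, n ∈ W ↔ ∃ s, E s n = true) :
    TuringReducible (charFun W : ℕ → ℕ) (inverseSettling E W : ℕ → ℕ) := by
  rw [TuringReducible, RecursiveIn.iff_nat]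
  set f := inverseSettling E W with hf
  have horacle : Nat.RecursiveIn {(f : ℕ →. ℕ)} fun n => Part.some (f n) := .oracle _ rfl
  -- Truncated subtraction: at `(n, f s)` it vanishes exactly when `n + 1 ≤ f s`, so `rfind` finds a
  -- stage correct at `n`.
  let G : ℕ → ℕ := fun x => x.unpair.1 + 1 - x.unpair.2
  have hG : Nat.Primrec G := by
    rw [← Primrec.nat_iff]
    exact Primrec.nat_sub.comp (Primrec.succ.comp (Primrec.fst.comp Primrec.unpair))
      (Primrec.snd.comp Primrec.unpair)
  let H : ℕ → ℕ := fun x => bif E x.unpair.2 x.unpair.1 then 1 else 0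
  have hH : Nat.Primrec H := by
    rw [← Primrec.nat_iff]
    exact Primrec.cond (hE.comp (Primrec.snd.comp Primrec.unpair)
      (Primrec.fst.comp Primrec.unpair)) (Primrec.const 1) (Primrec.const 0)
  have hsearch : Nat.RecursiveIn {(f : ℕ →. ℕ)}
      fun x => Part.some (G (Nat.pair x.unpair.1 (f x.unpair.2))) :=
    (Nat.RecursiveIn.of_primrec hG).comp_total
      ((Nat.RecursiveIn.of_primrec Nat.Primrec.left).pair_total
        (horacle.comp_total (Nat.RecursiveIn.of_primrec Nat.Primrec.right)))
  refine ((Nat.RecursiveIn.of_primrec hH).comp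
    ((Nat.RecursiveIn.of_primrec Nat.Primrec.id).pair hsearch.rfind)).of_eq_tot fun n => ?_
  obtain ⟨m, hm⟩ := exists_le_inverseSettling hmono hW (n + 1)
  have hdom : ∃ m, m ∈ Nat.rfind fun m => (Part.some (decide (n + 1 - f m = 0)) : Part Bool) := by
    obtain ⟨m', h, -⟩ := Nat.rfind_min' (p := fun m => decide (n + 1 - f m = 0)) (m := m)
      (by simpa [Nat.sub_eq_zero_iff_le] using hm)
    exact ⟨m', h⟩
  obtain ⟨s, hs⟩ := hdom
  have hs' : n + 1 ≤ f s := by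
    simpa [Nat.sub_eq_zero_iff_le] using Nat.rfind_spec hs
  have hval : H (Nat.pair n s) = charFun W n := by
    have hiff : E s n = true ↔ n ∈ W :=
      ⟨fun h => (hW n).2 ⟨s, h⟩, (le_inverseSettling_iff.1 hs').2 n (Nat.lt_succ_self n)⟩
    by_cases h : n ∈ W
    · simp [H, charFun, h, hiff.2 h]
    · have : E s n = false := by simpa using fun h' => h (hiff.1 h')
      simp [H, charFun, h, this]
  rw [Part.bind_eq_bind, Part.mem_bind_iff]
  refine ⟨Nat.pair n s, ?_, by rw [hval]; exact Part.mem_some _⟩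
  simp only [id_eq, Seq.seq, Part.map_eq_map, Part.map_some, Part.bind_some, Part.mem_map_iff,
    Nat.unpair_pair, G]
  exact ⟨s, hs, rfl⟩

end InverseSettling

/-! ### Lowness of the inverse settling function -/

section Low

variable {E : ℕ → ℕ → Bool} {W : Set ℕ}

/-- After truncation at `i` only membership below `i` matters, and there stage `m` already equals
`W`. The left side no longer mentions `W`. -/
theorem agree_stage_eq_min_inverseSettling (hW : ∀ n, n ∈ W ↔ ∃ s, E s n = true) {i m : ℕ}
    (hm : ∀ k < i, k ∈ W → E m k = true) (n : ℕ) :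
    agree E (E m) n (min n i) = min (inverseSettling E W n) i := by
  classical
  have : agree E (E m) n (min n i) = agree E (fun k => decide (k ∈ W)) n (min n i) := by
    refine agree_congr fun k hk => ?_
    rw [Bool.eq_iff_iff, decide_eq_true_iff]
    exact ⟨fun h => (hW k).2 ⟨m, h⟩, hm k (hk.trans_le (min_le_right _ _))⟩
  rw [this, agree_min]
  unfold inverseSettling
  congr!

theorem computable_of_partrec_bound (hE : Primrec₂ E) (hW : ∀ n, n ∈ W ↔ ∃ s, E s n = true)
    {M : ℕ →. ℕ} (hM : Partrec M) (hMW : ∀ i, ∃ m ∈ M i, ∀ k < i, k ∈ W → E m k = true) :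
    Computable (charFun W) := by
  have h : Partrec fun n => (M (n + 1)).map fun m => bif E m n then 1 else 0 := by
    refine (hM.comp Computable.succ).map ?_
    exact (Primrec.cond (hE.comp Primrec.snd Primrec.fst) (Primrec.const 1)
      (Primrec.const 0)).to_comp
  refine h.of_eq fun n => Part.eq_some_iff.2 ?_
  obtain ⟨m, hm, hmW⟩ := hMW (n + 1)
  refine (Part.mem_map_iff _).2 ⟨m, hm, ?_⟩
  have hiff : E m n = true ↔ n ∈ W := ⟨fun h => (hW n).2 ⟨m, h⟩, hmW n (Nat.lt_succ_self n)⟩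
  by_cases hn : n ∈ W
  · simp [charFun, hn, hiff.2 hn]
  · have : E m n = false := by simpa using fun h' => hn (hiff.1 h')
    simp [charFun, hn, this]

theorem lowForPunctualIsomorphism_inverseSettling (hE : Primrec₂ E)
    (hmono : ∀ s s' n, s ≤ s' → E s n = true → E s' n = true)
    (hW : ∀ n, n ∈ W ↔ ∃ s, E s n = true) (hnc : ¬ Computable (charFun W)) :
    LowForPunctualIsomorphism (inverseSettling E W) := by
  intro L _ _ harF harR A B ⟨⟨F, hF, hFA⟩, R, hR, hRA⟩ ⟨⟨F', hF', hFB⟩, R', hR', hRB⟩ g ⟨Ψ, hΨ⟩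
  by_contra hiso
  -- The truncated oracle for `a = (i, m)`, primitive recursive even when stage `m` is wrong below
  -- `i`.
  let X : ℕ × ℕ → ℕ → ℕ := fun a n => agree E (E a.2) n (min n a.1)
  have hX : Primrec₂ X := primrec_agree (α := (ℕ × ℕ) × ℕ) (V := fun p => E p.1.2)
    (n := fun p => p.2) (k := fun p => min p.2 p.1.1) hE
    (hE.comp (Primrec.snd.comp (Primrec.fst.comp Primrec.fst)) Primrec.snd) Primrec.snd
    (Primrec.nat_min.comp Primrec.snd (Primrec.fst.comp Primrec.fst))
  have hΨX := Ψ.primrec_eval hX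
  -- Otherwise `Ψ` with oracle `X a` would give a punctual isomorphism. No correctness of the stage
  -- is required, so the search below always halts.
  have hdefect : ∀ a, ∃ b t, isoDefect F F' R R' (Ψ.eval (X a)) b t = true := by
    intro a
    by_contra! hno
    obtain ⟨e, he, he'⟩ := exists_iso_of_isoDefect_eq_false hFA hFB hRA hRB
      fun b t => Bool.eq_false_iff.2 (hno b t)
    have hJ : Primrec (Ψ.eval (X a)) := hΨX.comp (Primrec.const a) Primrec.id
    have h2 : Primrec fun k : ℕ => 2 * k := Primrec.nat_mul.comp (Primrec.const 2) Primrec.id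
    refine hiso ⟨e, Primrec.nat_iff.1 ?_, Primrec.nat_iff.1 ?_⟩
    · exact (hJ.comp h2).of_eq fun k => (he k).symm
    · exact (hJ.comp (Primrec.succ.comp h2)).of_eq fun k => (he' k).symm
  -- The query bound of a defect is itself a stage correct one place further.
  have hnext : ∀ i m b t, (∀ k < i, k ∈ W → E m k = true) →
      isoDefect F F' R R' (Ψ.eval (X (i, m))) b t = true →
      ∀ k < i + 1, k ∈ W → E (Ψ.useBelow (X (i, m)) (2 * b + 2)) k = true := by
    intro i m b t hm hbt
    by_contra hno
    have hsmall : ∀ n < Ψ.useBelow (X (i, m)) (2 * b + 2), inverseSettling E W n ≤ i := by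
      intro n hn
      by_contra! hlt
      exact hno fun k hk hkW =>
        hmono _ _ _ hn.le ((le_inverseSettling_iff.1 hlt).2 k hk hkW)
    have hagree : ∀ k < 2 * b + 2, Ψ.eval (X (i, m)) k = Ψ.eval (inverseSettling E W) k :=
      fun k hk => Ψ.eval_eq_of_agree_useBelow (fun n hn => by
        rw [← min_eq_left (hsmall n hn)]
        exact agree_stage_eq_min_inverseSettling hW hm n) hk
    rw [isoDefect_congr hagree, hΨ, isoDefect_joinFun hFA hFB hRA hRB] at hbt
    exact Bool.false_ne_true hbt
  let step : ℕ × ℕ →. ℕ := fun a =>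
    (Nat.rfind fun x => Part.some
      (isoDefect F F' R R' (Ψ.eval (X a)) x.unpair.1 x.unpair.2)).map
      fun x => Ψ.useBelow (X a) (2 * x.unpair.1 + 2)
  have hstep : Partrec step := by
    have hb : Primrec fun p : (ℕ × ℕ) × ℕ => p.2.unpair.1 :=
      Primrec.fst.comp (Primrec.unpair.comp Primrec.snd)
    have ht : Primrec fun p : (ℕ × ℕ) × ℕ => p.2.unpair.2 :=
      Primrec.snd.comp (Primrec.unpair.comp Primrec.snd)
    refine Partrec.map (Partrec.rfind ?_) ?_
    · exact (computable_isoDefect harF harR hF hF' hR hR'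
        (J := fun p : (ℕ × ℕ) × ℕ => Ψ.eval (X p.1))
        (hΨX.comp (Primrec.fst.comp Primrec.fst) Primrec.snd) hb.to_comp ht.to_comp).partrec
    · exact ((Ψ.primrec_useBelow hX).comp Primrec.fst (Primrec.succ.comp (Primrec.succ.comp
        (Primrec.nat_mul.comp (Primrec.const 2) hb)))).to_comp
  -- Starting from stage `0`, vacuously correct below `0`, `M i` is a stage correct below `i`.
  let M : ℕ →. ℕ := fun i => i.rec (Part.some 0) fun y IH => IH.bind fun m => step (y, m)
  have hM : Partrec M :=
    Partrec.nat_rec (f := fun i : ℕ => i) (g := fun _ => Part.some 0)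
      (h := fun _ q => step q) Computable.id (Computable.const 0).partrec
      (hstep.comp Computable.snd)
  refine hnc (computable_of_partrec_bound hE hW hM fun i => ?_)
  induction i with
  | zero => exact ⟨0, Part.mem_some _, fun k hk => absurd hk (Nat.not_lt_zero k)⟩
  | succ i ih =>
    obtain ⟨m, hm, hmW⟩ := ih
    obtain ⟨b, t, hbt⟩ := hdefect (i, m)
    obtain ⟨x, hx, -⟩ := Nat.rfind_min' (m := Nat.pair b t)
      (p := fun x => isoDefect F F' R R' (Ψ.eval (X (i, m))) x.unpair.1 x.unpair.2)
      (by simpa using hbt)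
    refine ⟨_, Part.mem_bind_iff.2 ⟨m, hm, (Part.mem_map_iff _).2 ⟨x, hx, rfl⟩⟩,
      hnext i m _ x.unpair.2 hmW ?_⟩
    simpa using Nat.rfind_spec hx

end Low

theorem turingDegreeOf_eq {f g : ℕ → ℕ} (hfg : TuringReducible f g) (hgf : TuringReducible g f) :
    turingDegreeOf f = turingDegreeOf g :=
  Quotient.sound (s := AntisymmRel.setoid _ TuringReducible) ⟨hfg, hgf⟩

theorem theorem4p1 (d : TuringDegree) (hce : IsCEDegree d) (hne : d ≠ zeroTuringDegree) :
    ∃ f : ℕ → ℕ, turingDegreeOf f = d ∧ LowForPunctualIsomorphism f := by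
  obtain ⟨W, hWre, rfl⟩ := hce
  obtain ⟨E, hE, hmono, hW⟩ := hWre.exists_primrec_stages
  refine ⟨inverseSettling E W, turingDegreeOf_eq (inverseSettling_turingReducible hE)
    (charFun_turingReducible hE hmono hW),
    lowForPunctualIsomorphism_inverseSettling hE hmono hW fun hc => hne ?_⟩
  exact turingDegreeOf_eq (Partrec.turingReducible hc)
    (Partrec.turingReducible (Computable.const 0))
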